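/- Let $S$ be a commutative semiring and $M$ an $S$-semimodule. The natural preorder on $M$ is: $x\leqslant y$ if and only if $y=x+z$ for some $z\in M$. Suppose that $M$ is naturally complete (every subset of $M$ has a unique infimum and a unique supremum for $\leqslant$) and naturally inf-semilattice ordered ($(x\wedge y)+z=(x+z)\wedge(y+z)$ for all $x,y,z\in M$, the meets being taken for $\leqslant$). Let $X$ be a finite digraph with vertex set $V_X$ and edge set $E_X$ (every edge $c$ has a source $\partial_-c$ and a target $\partial_+c$; loops and parallel edges are allowed), weighted by elements $\omega_c\in M$ $(c\in E_X)$. Let $e\in E_X$ be an edge such that $X-e$ is acyclic, that is, contains no directed loop. A flow is a function $\phi:E_X\to M$ such that $\phi(c)\leqslant\omega_c$ for every edge $c$ and $\sum_{\partial_-c=v}\phi(c)=\sum_{\partial_+c=v}\phi(c)$ for every vertex $v$. A cellular $S$-sheaf $\mathcal F$ on $X$ assigns an $S$-semimodule to every vertex and every edge, and an $S$-homomorphism $\mathcal F(v)\to\mathcal F(c)$ to every endpoint $v$ of every edge $c$; it is flat if tensoring with each $\mathcal F(v)$ and each $\mathcal F(c)$ preserves equalizers of $S$-semimodules. An $\mathcal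 F$-flow consists, for every edge $c$, of an element of $\mathcal F(v)$ for each endpoint $v$ of $c$, these elements having the same image in $\mathcal F(c)$, such that at every vertex $v$ the sum in $\mathcal F(v)$ over the edges with source $v$ equals the sum over the edges with target $v$. A flow $\phi$ is $S$-decomposable if it is the image of an $\mathcal F$-flow under a natural transformation from some flat cellular $S$-sheaf $\mathcal F$ on $X$ to the constant sheaf at $M$. An $e$-cut is either the set $\{e\}$ or a set of the form $\{c\in E_X:\partial_-c\in A,\ \partial_+c\notin A\}$ where $A\subset V_X$, $\partial_+e\in A$ and $\partial_-e\notin A$. Then $$\bigvee_{\phi\ S\text{-decomposable flow}}\phi(e)\;=\;\bigwedge_{C\ e\text{-cut}}\ \sum_{c\in C}\omega_c .$$ If moreover $\omega_e$ is the greatest element of $M$ (so that $e$ is unconstrained), then the meet on the right may be taken over the $e$-cuts of the second form only. -/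

import Mathlib

open scoped TensorProduct BigOperators

namespace AlgMFMC

universe u v w

/-! ### The natural preorder of a semimodule -/

section Order

variable {M : Type v} [AddCommMonoid M]

/-- The natural preorder: `x ≤ y` iff `y = x + z` for some `z`; its upper sets are the additive
ideals.  (Over a nontrivial semiring `S` the elements `l • z`, with `l ≠ 0` in `S` and `z` in `M`,
exhaust `M`, so that the relations `x ≤ l • z + x` define the same preorder.) -/
def NatLE (x y : M) : Prop := ∃ z : M, y = x + z

/-- `m` is a greatest lower bound of `s` for the natural preorder. -/
def IsNatGLB (s : Set M) (m : M) : Prop :=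
  (∀ x ∈ s, NatLE m x) ∧ ∀ b : M, (∀ x ∈ s, NatLE b x) → NatLE b m

/-- `m` is a least upper bound of `s` for the natural preorder. -/
def IsNatLUB (s : Set M) (m : M) : Prop :=
  (∀ x ∈ s, NatLE x m) ∧ ∀ b : M, (∀ x ∈ s, NatLE x b) → NatLE m b

variable (M) in
/-- Every subset has a unique infimum and a unique supremum for the natural preorder. -/
def NaturallyComplete : Prop :=
  ∀ s : Set M, (∃! m, IsNatGLB s m) ∧ (∃! m, IsNatLUB s m)

variable (M) in
/-- Every pair has a unique greatest lower bound `x ⊓ y` for the natural preorder, and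
`(x ⊓ y) + z = (x + z) ⊓ (y + z)`. -/
def NaturallyInfSemilatticeOrdered : Prop :=
  (∀ x y : M, ∃! m, IsNatGLB {x, y} m) ∧
  ∀ x y z m : M, IsNatGLB {x, y} m → IsNatGLB {x + z, y + z} (m + z)

end Order

/-! ### Digraphs -/

/-- A digraph all of whose edges have a source and a target; loops and parallel edges are allowed.
Together with finiteness of `V` and `E` this is a compact digraph. -/
structure DiGraph (V : Type*) (E : Type*) where
  src : E → V
  tgt : E → V

namespace DiGraph

variable {V E : Type*} (X : DiGraph V E)

/-- The vertex `v` is a face of the edge `c`. -/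
def Incident (v : V) (c : E) : Prop := v = X.src c ∨ v = X.tgt c

/-- The vertices `W` and the edges `L` form a directed loop: a nonempty subdigraph, containing the
endpoints of its edges, in which every vertex has in-degree `1` and out-degree `1`. -/
def IsDirectedLoop (W : Set V) (L : Set E) : Prop :=
  W.Nonempty ∧ (∀ c ∈ L, X.src c ∈ W ∧ X.tgt c ∈ W) ∧
  ∀ v ∈ W, (∃! c, c ∈ L ∧ X.src c = v) ∧ (∃! c, c ∈ L ∧ X.tgt c = v)

/-- The digraph `X - e` contains no directed loop. -/
def AcyclicWithout (e : E) : Prop :=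
  ∀ (W : Set V) (L : Set E), X.IsDirectedLoop W L → e ∈ L

/-- `C` is the set `A : V - A` of the edges from `A` to `V - A`, for a vertex set `A` that
contains `s` and does not contain `t`. -/
def IsCut (s t : V) (C : Finset E) : Prop :=
  ∃ A : Set V, s ∈ A ∧ t ∉ A ∧ ∀ c : E, c ∈ C ↔ X.src c ∈ A ∧ X.tgt c ∉ A

/-- The cuts that separate the target of `e` from the source of `e`. -/
def IsProperEdgeCut (e : E) (C : Finset E) : Prop := X.IsCut (X.tgt e) (X.src e) C

/-- An `e`-cut: either the edge `e` alone, or a cut that separates the target of `e` from its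
source. -/
def IsEdgeCut (e : E) (C : Finset E) : Prop := C = {e} ∨ X.IsProperEdgeCut e C

end DiGraph

/-! ### Flows -/

/-- A flow on the weighted digraph `(X; ω)`: capacities are respected and, at every vertex, the
outgoing and the incoming values have the same sum. -/
def IsFlow {V E : Type*} [Fintype E] {M : Type v} [AddCommMonoid M]
    (X : DiGraph V E) (ω : E → M) (φ : E → M) : Prop :=
  open scoped Classical in
  (∀ c, NatLE (φ c) (ω c)) ∧
  ∀ v : V, (∑ c : {c : E // X.src c = v}, φ c.1) = ∑ c : {c : E // X.tgt c = v}, φ c.1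

/-! ### Flat semimodules and sheaves -/

/-- `F` is flat: tensoring with `F` preserves equalizers of `S`-semimodules. -/
def FlatSemimodule (S : Type u) [CommSemiring S] (F : Type (max u w)) [AddCommMonoid F]
    [Module S F] : Prop :=
  ∀ (A B : Type (max u w)) [AddCommMonoid A] [AddCommMonoid B] [Module S A] [Module S B]
    (f g : A →ₗ[S] B),
    Function.Injective (LinearMap.lTensor F (LinearMap.eqLocus f g).subtype) ∧
    ∀ t : F ⊗[S] A, LinearMap.lTensor F f t = LinearMap.lTensor F g t →
      t ∈ LinearMap.range (LinearMap.lTensor F (LinearMap.eqLocus f g).subtype)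

/-- A cellular `S`-sheaf on `X`: an `S`-semimodule for every vertex and every edge, and a
restriction map from a vertex to an edge for every incidence. -/
structure CellSheaf (S : Type u) [CommSemiring S] {V E : Type*} (X : DiGraph V E) where
  onV : V → Type (max u w)
  onE : E → Type (max u w)
  [acmV : ∀ v, AddCommMonoid (onV v)]
  [acmE : ∀ c, AddCommMonoid (onE c)]
  [modV : ∀ v, Module S (onV v)]
  [modE : ∀ c, Module S (onE c)]
  res : ∀ (v : V) (c : E), X.Incident v c → onV v →ₗ[S] onE c

attribute [instance] CellSheaf.acmV CellSheaf.acmE CellSheaf.modV CellSheaf.modE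

namespace CellSheaf

variable {S : Type u} [CommSemiring S] {V E : Type*} {X : DiGraph V E}

/-- A sheaf is flat if all its stalks are flat. -/
def Flat (F : CellSheaf.{u, w} S X) : Prop :=
  (∀ v, FlatSemimodule.{u, w} S (F.onV v)) ∧ ∀ c, FlatSemimodule.{u, w} S (F.onE c)

/-- A natural transformation from `F` to the constant sheaf at `M`. -/
structure HomToConst (F : CellSheaf.{u, w} S X) (M : Type v) [AddCommMonoid M] [Module S M] where
  onV : ∀ v, F.onV v →ₗ[S] M
  onE : ∀ c, F.onE c →ₗ[S] M
  naturality : ∀ (v : V) (c : E) (h : X.Incident v c) (x : F.onV v),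
    onE c (F.res v c h x) = onV v x

/-- An `F`-flow: for every edge `c` a section of `F` over the closure of `c` (a value at each
endpoint of `c`, the values having the same restriction to `c`), such that at every vertex the
outgoing and the incoming values have the same sum. -/
structure SheafFlow [Fintype E] (F : CellSheaf.{u, w} S X) where
  val : ∀ (v : V) (c : E), X.Incident v c → F.onV v
  compat : ∀ (v v' : V) (c : E) (h : X.Incident v c) (h' : X.Incident v' c),
    F.res v c h (val v c h) = F.res v' c h' (val v' c h')
  conserve : ∀ v : V,
    open scoped Classical in
    (∑ c : {c : E // X.src c = v}, val v c.1 (Or.inl c.2.symm)) =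
      ∑ c : {c : E // X.tgt c = v}, val v c.1 (Or.inr c.2.symm)

end CellSheaf

/-- `φ` is (locally) `S`-decomposable: it is the image of an `F`-flow under a natural
transformation from a flat `S`-sheaf `F` on `X`. -/
def IsDecomposable (S : Type u) [CommSemiring S] {V E : Type*} [Fintype E] {M : Type v}
    [AddCommMonoid M] [Module S M] (X : DiGraph V E) (φ : E → M) : Prop :=
  ∃ (F : CellSheaf.{u, v} S X) (_ : F.Flat) (τ : F.HomToConst M) (s : F.SheafFlow),
    ∀ (v : V) (c : E) (h : X.Incident v c), τ.onV v (s.val v c h) = φ c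

/-- The values at `e` of the `S`-decomposable flows on `(X; ω)`.  The digraph being finite, all
flows are finite. -/
def flowValues (S : Type u) [CommSemiring S] {V E : Type*} [Fintype E] {M : Type v}
    [AddCommMonoid M] [Module S M] (X : DiGraph V E) (ω : E → M) (e : E) : Set M :=
  {x | ∃ φ : E → M, IsFlow X ω φ ∧ IsDecomposable S X φ ∧ φ e = x}

end AlgMFMC

/-!
Write the capacities as an `ℕ`-linear map `φ` on the free semimodule `E → ℕ`, so that the cut sums
are the values of `φ` at `0`-`1` vectors. If two generators `x`, `y` obstruct the coefficientwise
computation of a meet of two such values, write them as `x ⊓ y` plus remainders and take `x ⊓ y` as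
a new generator. Distributivity of addition over meets makes the meet of the remainders negligible
against forms that contain `x ⊓ y`, and this is what remains of cancellation. The sizes of the
obstructions decrease in the Dershowitz–Manna order, so finitely many splittings bring the meet of
all cut sums to the value at a coefficientwise meet. There the claim is integral max-flow min-cut
in every coordinate, which follows from Hoffman's circulation theorem; the flow so obtained factors
through a finite free, hence flat, sheaf.

For the converse inequality, the capacity of a proper `e`-cut bounds the value of a flow at `e`
because the total flow across the cut is the same in both directions. In the absence of cancellation
this is where acyclicity of `X - e` is needed.
-/

namespace AlgMFMC

section Absorption

theorem monotone_of_canonicallyOrderedAdd {F A B : Type*} [Add A] [Preorder A] [ExistsAddOfLE A]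
    [Add B] [Preorder B] [CanonicallyOrderedAdd B] [FunLike F A B] [AddHomClass F A B] (f : F) :
    Monotone f := by
  intro x y hxy
  obtain ⟨z, rfl⟩ := exists_add_of_le hxy
  exact le_self_add.trans_eq (map_add f x z).symm

theorem linearMap_pi_apply_eq_sum_single {R ι M : Type*} [Semiring R] [AddCommMonoid M]
    [Module R M] [Fintype ι] [DecidableEq ι] (φ : (ι → R) →ₗ[R] M) (c : ι → R) :
    φ c = ∑ i, c i • φ (Pi.single i 1) := by
  conv_lhs => rw [← Finset.univ_sum_single c, map_sum]
  exact Finset.sum_congr rfl fun i _ ↦ by rw [← map_smul, ← Pi.single_smul, smul_eq_mul, mul_one]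

/-- The distributive law of an inf-semilattice ordered monoid: translations preserve binary
meets. -/
class InfDistribAdd (M : Type*) [Add M] [SemilatticeInf M] : Prop where
  inf_add (x y z : M) : x ⊓ y + z = (x + z) ⊓ (y + z)

/-- `k` is negligible compared with `w`; in a canonically ordered monoid, `w + k = w`. For want of
cancellation this takes the place of `k = 0`. -/
def Absorbs {M : Type*} [Add M] [LE M] (w k : M) : Prop := w + k ≤ w

attribute [local instance] CanonicallyOrderedAdd.toIsOrderedAddMonoid

namespace Absorbs

section Preorder

variable {M : Type*} [AddCommMonoid M] [Preorder M] [CanonicallyOrderedAdd M] {w w' k k' : M}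

theorem mono_left (hk : Absorbs w k) (hw : w ≤ w') : Absorbs w' k := by
  obtain ⟨z, rfl⟩ := exists_add_of_le hw
  rw [Absorbs, add_right_comm]
  exact add_le_add_left hk z

theorem mono_right (hk : Absorbs w k) (hk' : k' ≤ k) : Absorbs w k' :=
  (add_le_add_right hk' w).trans hk

theorem add (hk : Absorbs w k) (hk' : Absorbs w k') : Absorbs w (k + k') := by
  rw [Absorbs, ← add_assoc]
  exact (add_le_add_left hk k').trans hk'

end Preorder

variable {M : Type*} [AddCommMonoid M] [SemilatticeInf M] [CanonicallyOrderedAdd M]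
  [InfDistribAdd M] {w x : M}

theorem inf_add {y z : M} (hy : Absorbs w (x ⊓ y)) (hz : Absorbs w (x ⊓ z)) :
    Absorbs w (x ⊓ (y + z)) := by
  refine (hy.add hz).mono_right ?_
  have hle : x ⊓ (y + z) ≤ y + x ⊓ z :=
    calc x ⊓ (y + z) ≤ (x + y) ⊓ (z + y) := by
          rw [add_comm z]; exact inf_le_inf_right _ le_self_add
      _ = y + x ⊓ z := by rw [← InfDistribAdd.inf_add, add_comm]
  calc x ⊓ (y + z) ≤ (x + x ⊓ z) ⊓ (y + x ⊓ z) := le_inf (inf_le_left.trans le_self_add) hle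
    _ = x ⊓ y + x ⊓ z := (InfDistribAdd.inf_add _ _ _).symm

theorem inf_sum {ι : Type*} (s : Finset ι) (y : ι → M) (h : ∀ i ∈ s, Absorbs w (x ⊓ y i)) :
    Absorbs w (x ⊓ ∑ i ∈ s, y i) :=
  Finset.sum_induction y (fun z ↦ Absorbs w (x ⊓ z)) (fun _ _ ↦ inf_add)
    (by simp [Absorbs]) h

theorem inf_nsmul {y : M} (n : ℕ) (h : n ≠ 0 → Absorbs w (x ⊓ y)) : Absorbs w (x ⊓ n • y) := by
  rw [← Fintype.card_fin n, ← Finset.card_univ, ← Finset.sum_const]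
  exact inf_sum _ _ fun i _ ↦ h (Nat.ne_zero_of_lt i.isLt)

theorem inf_linearMap {ι : Type*} [Finite ι] [DecidableEq ι] (φ : (ι → ℕ) →ₗ[ℕ] M) (c : ι → ℕ)
    (h : ∀ i, c i ≠ 0 → Absorbs w (x ⊓ φ (Pi.single i 1))) : Absorbs w (x ⊓ φ c) := by
  have := Fintype.ofFinite ι
  rw [linearMap_pi_apply_eq_sum_single φ c]
  exact inf_sum _ _ fun i _ ↦ inf_nsmul _ (h i)

end Absorbs

end Absorption

section Refinement

universe u

theorem isDershowitzMannaLT_map_of_embedding {α β γ : Type*} [Preorder γ] {K : Finset α}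
    {K' : Finset β} {s : α → γ} {s' : β → γ} (g : α ↪ β) {p₀ : α} (hp₀ : p₀ ∈ K) (hgp₀ : g p₀ ∉ K')
    (hs : ∀ p, s' (g p) = s p) (h : ∀ q ∈ K', (∃ p ∈ K, g p = q) ∨ s' q < s p₀) :
    Multiset.IsDershowitzMannaLT (K'.val.map s') (K.val.map s) := by
  classical
  let old := K.filter fun p ↦ g p ∈ K'
  have hold : old.map g ⊆ K' := by
    simp only [Finset.subset_iff, Finset.mem_map, old, Finset.mem_filter]
    rintro _ ⟨p, hp, rfl⟩
    exact hp.2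
  refine ⟨old.val.map s, (K' \ old.map g).val.map s', (K \ old).val.map s, ?_, ?_, ?_, ?_⟩
  · have hp₀old : p₀ ∈ K \ old := by simp [old, hp₀, hgp₀]
    exact Multiset.map_eq_zero.not.2 (Finset.val_eq_zero.not.2 (Finset.ne_empty_of_mem hp₀old))
  · have : old.val.map s = (old.map g).val.map s' := by simp [Finset.map_val, hs]
    rw [this, ← Multiset.map_add, Finset.sdiff_val,
      add_tsub_cancel_of_le (Finset.val_le_iff.2 hold)]
  · rw [← Multiset.map_add, Finset.sdiff_val,
      add_tsub_cancel_of_le (Finset.val_le_iff.2 (Finset.filter_subset _ _))]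
  · simp only [Multiset.mem_map, Finset.mem_val, Finset.mem_sdiff]
    rintro _ ⟨q, ⟨hq, hqold⟩, rfl⟩
    refine ⟨s p₀, ⟨p₀, by simp [old, hp₀, hgp₀], rfl⟩, (h q hq).resolve_left ?_⟩
    rintro ⟨p, hp, rfl⟩
    exact hqold (Finset.mem_map_of_mem g (by simp [old, hp, hq]))

attribute [local instance] CanonicallyOrderedAdd.toIsOrderedAddMonoid

variable {M : Type*} [AddCommMonoid M] [SemilatticeInf M] {ι : Type u}

/-- The meet of the `ℕ`-linear forms `φ a` and `φ b` is computed coefficientwise, once the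
generators `φ (Pi.single i 1)` have been written as combinations of finitely many elements of
`M`. -/
def MeetResolves (φ : (ι → ℕ) →ₗ[ℕ] M) (a b : ι → ℕ) : Prop :=
  ∃ (κ : Type u) (_ : Finite κ) (ψ : (κ → ℕ) →ₗ[ℕ] M) (T : (ι → ℕ) →ₗ[ℕ] (κ → ℕ)),
    ψ ∘ₗ T = φ ∧ φ a ⊓ φ b ≤ ψ (T a ⊓ T b)

theorem MeetResolves.of_comp {κ : Type u} {ψ : (κ → ℕ) →ₗ[ℕ] M} {T : (ι → ℕ) →ₗ[ℕ] (κ → ℕ)}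
    {a b : ι → ℕ} (h : MeetResolves ψ (T a) (T b)) : MeetResolves (ψ ∘ₗ T) a b := by
  obtain ⟨ν, _, χ, U, rfl, hle⟩ := h
  exact ⟨ν, inferInstance, χ, U ∘ₗ T, rfl, hle⟩

/-- The coefficients of a form after the generators `i` and `j` have been written as a new
generator `none` plus remainders. -/
def splitCoeff (i j : ι) : (ι → ℕ) →ₗ[ℕ] (Option ι → ℕ) where
  toFun a o := o.elim (a i + a j) a
  map_add' a b := by
    ext (_ | k)
    · exact add_add_add_comm _ _ _ _
    · rfl
  map_smul' n a := by
    ext (_ | k)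
    · exact (mul_add _ _ _).symm
    · rfl

theorem splitCoeff_none (i j : ι) (a : ι → ℕ) : splitCoeff i j a none = a i + a j := rfl

theorem splitCoeff_some (i j k : ι) (a : ι → ℕ) : splitCoeff i j a (some k) = a k := rfl

/-- The excess of `a` over `b` at `p.1` plus the excess of `b` over `a` at `p.2`, each of them zero
if negative. -/
def crossingSize (a b : ι → ℕ) (p : ι × ι) : ℕ := (a p.1 - b p.1) + (b p.2 - a p.2)

theorem crossingSize_splitCoeff_lt {i j : ι} {a b : ι → ℕ} (hi : b i < a i) (hj : a j < b j)
    {p q : Option ι} (hpq : p = none ∨ q = none) :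
    crossingSize (splitCoeff i j a) (splitCoeff i j b) (p, q) <
      crossingSize a b (p.getD i, q.getD j) := by
  rcases p with _ | k <;> rcases q with _ | l <;>
    simp only [crossingSize, splitCoeff_none, splitCoeff_some, Option.getD_none, Option.getD_some,
      reduceCtorEq, or_self] at hpq ⊢ <;> omega

section Crossings

variable [DecidableEq ι]

/-- The pair `(i, j)` obstructs the coefficientwise computation of `φ a ⊓ φ b`: the forms disagree
in opposite directions at `i` and `j`, and the meet of these two generators is not absorbed by the
common part of the forms. -/
def IsCrossing (φ : (ι → ℕ) →ₗ[ℕ] M) (a b : ι → ℕ) (i j : ι) : Prop :=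
  b i < a i ∧ a j < b j ∧ ¬ Absorbs (φ (a ⊓ b)) (φ (Pi.single i 1) ⊓ φ (Pi.single j 1))

theorem meetResolves_of_forall_not_isCrossing [CanonicallyOrderedAdd M] [InfDistribAdd M]
    [Finite ι] {φ : (ι → ℕ) →ₗ[ℕ] M} {a b : ι → ℕ} (h : ∀ i j, ¬ IsCrossing φ a b i j) :
    MeetResolves φ a b := by
  have habs : Absorbs (φ (a ⊓ b)) (φ (a - b) ⊓ φ (b - a)) := by
    refine .inf_linearMap φ _ fun j hj ↦ ?_
    rw [inf_comm (φ _)]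
    refine .inf_linearMap φ _ fun i hi ↦ ?_
    rw [inf_comm (φ _)]
    by_contra hij
    exact h i j ⟨Nat.lt_of_sub_ne_zero hi, Nat.lt_of_sub_ne_zero hj, hij⟩
  have ha : a - b + a ⊓ b = a := funext fun i ↦ tsub_add_min
  have hb : b - a + a ⊓ b = b := by rw [inf_comm]; exact funext fun i ↦ tsub_add_min
  refine ⟨ι, inferInstance, φ, LinearMap.id, rfl, ?_⟩
  calc φ a ⊓ φ b = (φ (a - b) + φ (a ⊓ b)) ⊓ (φ (b - a) + φ (a ⊓ b)) := by
        rw [← map_add, ← map_add, ha, hb]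
    _ = φ (a ⊓ b) + φ (a - b) ⊓ φ (b - a) := by rw [← InfDistribAdd.inf_add, add_comm]
    _ ≤ φ (a ⊓ b) := habs

section Split

variable {i j : ι}

theorem single_le_splitCoeff_getD_left (p : Option ι) :
    Pi.single p 1 ≤ splitCoeff i j (Pi.single (p.getD i) 1) := by
  rintro (_ | k) <;> rcases p with _ | l <;>
    simp [splitCoeff_none, splitCoeff_some, Pi.single_apply]

theorem single_le_splitCoeff_getD_right (p : Option ι) :
    Pi.single p 1 ≤ splitCoeff i j (Pi.single (p.getD j) 1) := by
  rintro (_ | k) <;> rcases p with _ | l <;>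
    simp [splitCoeff_none, splitCoeff_some, Pi.single_apply]

theorem single_some_add_single_none_le_left :
    Pi.single (some i) 1 + Pi.single none 1 ≤ splitCoeff i j (Pi.single i 1) := by
  rintro (_ | k) <;> simp [splitCoeff_none, splitCoeff_some, Pi.single_apply]

theorem single_some_add_single_none_le_right :
    Pi.single (some j) 1 + Pi.single none 1 ≤ splitCoeff i j (Pi.single j 1) := by
  rintro (_ | k) <;> simp [splitCoeff_none, splitCoeff_some, Pi.single_apply]

theorem exists_comp_splitCoeff [CanonicallyOrderedAdd M] [Finite ι] (φ : (ι → ℕ) →ₗ[ℕ] M)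
    (hij : i ≠ j) : ∃ ψ : (Option ι → ℕ) →ₗ[ℕ] M, ψ ∘ₗ splitCoeff i j = φ ∧
      ψ (Pi.single none 1) = φ (Pi.single i 1) ⊓ φ (Pi.single j 1) := by
  have := Fintype.ofFinite ι
  set d := φ (Pi.single i 1) ⊓ φ (Pi.single j 1)
  obtain ⟨x, hx⟩ := exists_add_of_le (inf_le_left : d ≤ φ (Pi.single i 1))
  obtain ⟨y, hy⟩ := exists_add_of_le (inf_le_right : d ≤ φ (Pi.single j 1))
  let g : ι → M := Function.update (Function.update (fun k ↦ φ (Pi.single k 1)) j y) i x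
  refine ⟨Fintype.linearCombination ℕ fun o : Option ι ↦ o.elim d g, ?_, ?_⟩
  · refine LinearMap.pi_ext' fun k ↦ LinearMap.ext_ring ?_
    have hsum : ∑ l, (Pi.single k 1 : ι → ℕ) l • g l = g k := by
      simp [Pi.single_apply]
    simp only [LinearMap.comp_apply, LinearMap.single_apply, Fintype.linearCombination_apply,
      Fintype.sum_option, splitCoeff_none, splitCoeff_some, Option.elim_none, Option.elim_some,
      hsum]
    rcases eq_or_ne k i with rfl | hki
    · simpa [g, hij.symm] using hx.symm
    rcases eq_or_ne k j with rfl | hkj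
    · simpa [g, hki, hki.symm] using hy.symm
    · simp [g, hki, hkj, hki.symm, hkj.symm]
  · simp [Fintype.linearCombination_apply_single]

variable {ψ : (Option ι → ℕ) →ₗ[ℕ] M} {a b : ι → ℕ} {p q : Option ι}

theorem IsCrossing.of_splitCoeff [CanonicallyOrderedAdd M] (hi : b i < a i) (hj : a j < b j)
    (h : IsCrossing ψ (splitCoeff i j a) (splitCoeff i j b) p q) :
    IsCrossing (ψ ∘ₗ splitCoeff i j) a b (p.getD i) (q.getD j) := by
  have hψ := monotone_of_canonicallyOrderedAdd ψ
  obtain ⟨hp, hq, habs⟩ := h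
  refine ⟨?_, ?_, fun hab ↦ habs ?_⟩
  · rcases p with _ | k
    exacts [hi, hp]
  · rcases q with _ | l
    exacts [hj, hq]
  · exact (hab.mono_left
      (hψ ((monotone_of_canonicallyOrderedAdd (splitCoeff i j)).map_inf_le a b))).mono_right
      (inf_le_inf (hψ (single_le_splitCoeff_getD_left p)) (hψ (single_le_splitCoeff_getD_right q)))

theorem not_isCrossing_splitCoeff [CanonicallyOrderedAdd M] [InfDistribAdd M]
    (hψ : ψ (Pi.single none 1) =
      ψ (splitCoeff i j (Pi.single i 1)) ⊓ ψ (splitCoeff i j (Pi.single j 1))) :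
    ¬ IsCrossing ψ (splitCoeff i j a) (splitCoeff i j b) (some i) (some j) := by
  rintro ⟨hi, hj, habs⟩
  have hmono := monotone_of_canonicallyOrderedAdd ψ
  have hnone : Pi.single none 1 ≤ splitCoeff i j a ⊓ splitCoeff i j b := by
    rw [splitCoeff_some, splitCoeff_some] at hi hj
    rintro (_ | k)
    · simp only [Pi.single_eq_same, Pi.inf_apply, splitCoeff_none, le_inf_iff]
      omega
    · simp
  refine habs (Absorbs.mono_left ?_ (hmono hnone))
  calc ψ (Pi.single none 1) + ψ (Pi.single (some i) 1) ⊓ ψ (Pi.single (some j) 1)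
      = ψ (Pi.single (some i) 1 + Pi.single none 1) ⊓
          ψ (Pi.single (some j) 1 + Pi.single none 1) := by
        rw [add_comm, InfDistribAdd.inf_add, map_add, map_add]
    _ ≤ ψ (Pi.single none 1) := by
        rw [hψ]
        exact inf_le_inf (hmono single_some_add_single_none_le_left)
          (hmono single_some_add_single_none_le_right)

end Split

variable [Fintype ι]

open scoped Classical in
/-- The finite set of crossings, as pairs. -/
noncomputable def crossings (φ : (ι → ℕ) →ₗ[ℕ] M) (a b : ι → ℕ) : Finset (ι × ι) :=
  {p | IsCrossing φ a b p.1 p.2}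

theorem mem_crossings {φ : (ι → ℕ) →ₗ[ℕ] M} {a b : ι → ℕ} {p : ι × ι} :
    p ∈ crossings φ a b ↔ IsCrossing φ a b p.1 p.2 := by
  simp [crossings]

/-- The sizes of all crossings; splitting at a crossing of maximal size decreases this multiset in
the Dershowitz–Manna order. -/
noncomputable def crossingSizes (φ : (ι → ℕ) →ₗ[ℕ] M) (a b : ι → ℕ) : Multiset ℕ :=
  (crossings φ a b).val.map (crossingSize a b)

variable [CanonicallyOrderedAdd M] [InfDistribAdd M]

theorem crossingSizes_splitCoeff_lt {i j : ι} {ψ : (Option ι → ℕ) →ₗ[ℕ] M} {a b : ι → ℕ}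
    (hψ : ψ (Pi.single none 1) =
      ψ (splitCoeff i j (Pi.single i 1)) ⊓ ψ (splitCoeff i j (Pi.single j 1)))
    (hij : (i, j) ∈ crossings (ψ ∘ₗ splitCoeff i j) a b)
    (hmax : ∀ p ∈ crossings (ψ ∘ₗ splitCoeff i j) a b,
      crossingSize a b p ≤ crossingSize a b (i, j)) :
    (crossingSizes ψ (splitCoeff i j a) (splitCoeff i j b)).IsDershowitzMannaLT
      (crossingSizes (ψ ∘ₗ splitCoeff i j) a b) := by
  obtain ⟨hi, hj, -⟩ := mem_crossings.1 hij
  refine isDershowitzMannaLT_map_of_embedding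
    (Function.Embedding.some.prodMap Function.Embedding.some) hij ?_ (fun p ↦ rfl) ?_
  · exact fun hcross ↦ not_isCrossing_splitCoeff hψ (mem_crossings.1 hcross)
  · rintro ⟨p, q⟩ hpq
    have hold : (p.getD i, q.getD j) ∈ crossings (ψ ∘ₗ splitCoeff i j) a b :=
      mem_crossings.2 ((mem_crossings.1 hpq).of_splitCoeff hi hj)
    by_cases hnone : p = none ∨ q = none
    · exact .inr ((crossingSize_splitCoeff_lt hi hj hnone).trans_le (hmax _ hold))
    · obtain ⟨⟨k, rfl⟩, l, rfl⟩ := by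
        simpa only [not_or, Option.ne_none_iff_exists'] using hnone
      exact .inl ⟨(k, l), hold, rfl⟩

end Crossings

variable [CanonicallyOrderedAdd M] [InfDistribAdd M] [Finite ι]

theorem meetResolves (φ : (ι → ℕ) →ₗ[ℕ] M) (a b : ι → ℕ) : MeetResolves φ a b := by
  have := Classical.decEq ι
  have := Fintype.ofFinite ι
  have hwf := Multiset.wellFounded_isDershowitzMannaLT (α := ℕ)
  induction hN : crossingSizes φ a b using hwf.induction generalizing ι with
  | h N ih =>
  subst hN
  rcases (crossings φ a b).eq_empty_or_nonempty with hempty | hne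
  · exact meetResolves_of_forall_not_isCrossing fun i j hij ↦
      Finset.notMem_empty (i, j) (hempty ▸ mem_crossings.2 hij)
  · obtain ⟨⟨i, j⟩, hij, hmax⟩ := (crossings φ a b).exists_max_image (crossingSize a b) hne
    have hij_ne : i ≠ j := by
      rintro rfl
      obtain ⟨hi, hj, -⟩ := mem_crossings.1 hij
      exact hi.not_gt hj
    obtain ⟨ψ, rfl, hψ⟩ := exists_comp_splitCoeff φ hij_ne
    exact (ih _ (crossingSizes_splitCoeff_lt hψ hij hmax) ψ _ _ _ _ rfl).of_comp

theorem exists_factorization_inf'_le (φ : (ι → ℕ) →ₗ[ℕ] M) {α : Type*} {s : Finset α}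
    (hs : s.Nonempty) (a : α → ι → ℕ) :
    ∃ (κ : Type u) (_ : Finite κ) (ψ : (κ → ℕ) →ₗ[ℕ] M) (T : (ι → ℕ) →ₗ[ℕ] (κ → ℕ)),
      ψ ∘ₗ T = φ ∧ s.inf' hs (φ ∘ a) ≤ ψ (s.inf' hs (T ∘ a)) := by
  induction hs using Finset.Nonempty.cons_induction with
  | singleton x => exact ⟨ι, inferInstance, φ, LinearMap.id, rfl, by simp⟩
  | cons x s hx hs ih =>
    obtain ⟨κ, _, ψ, T, rfl, hle⟩ := ih
    obtain ⟨ν, _, χ, U, rfl, hle'⟩ := meetResolves ψ (T (a x)) (s.inf' hs (T ∘ a))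
    refine ⟨ν, inferInstance, χ, U ∘ₗ T, rfl, ?_⟩
    have hU : U (s.inf' hs (T ∘ a)) ≤ s.inf' hs ((U ∘ₗ T) ∘ a) :=
      Finset.le_inf' _ _ fun y hy ↦ monotone_of_canonicallyOrderedAdd U (Finset.inf'_le _ hy)
    rw [Finset.inf'_cons hs, Finset.inf'_cons hs]
    exact (inf_le_inf_left _ hle).trans
      (hle'.trans (monotone_of_canonicallyOrderedAdd χ (inf_le_inf_left _ hU)))

end Refinement

section Flux

variable {V E : Type*} [Fintype E] {N N' : Type*} [AddCommMonoid N] [AddCommMonoid N']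
  (X : DiGraph V E) {φ : E → N} {P P' Q Q' : Set V}

open scoped Classical in
/-- The conservation law of a flow: at every vertex the outgoing and the incoming values have the
same sum. -/
def IsCirculation (φ : E → N) : Prop :=
  ∀ v : V, (∑ c : {c : E // X.src c = v}, φ c.1) = ∑ c : {c : E // X.tgt c = v}, φ c.1

open scoped Classical in
/-- The total value of `φ` on the edges from `P` to `Q`. -/
noncomputable def flux (φ : E → N) (P Q : Set V) : N :=
  ∑ c with X.src c ∈ P ∧ X.tgt c ∈ Q, φ c

variable {X}

theorem isCirculation_iff_flux :
    IsCirculation X φ ↔ ∀ v, flux X φ {v} Set.univ = flux X φ Set.univ {v} := by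
  classical
  refine forall_congr' fun v ↦ ?_
  rw [← Finset.sum_subtype {c | X.src c = v} (by simp) φ,
    ← Finset.sum_subtype {c | X.tgt c = v} (by simp) φ]
  simp only [flux, Set.mem_singleton_iff, Set.mem_univ, and_true, true_and]

theorem IsCirculation.map {F : Type*} [FunLike F N N'] [AddMonoidHomClass F N N']
    (hφ : IsCirculation X φ) (g : F) : IsCirculation X (g ∘ φ) := fun v ↦ by
  simpa only [Function.comp_apply, map_sum] using congrArg g (hφ v)

theorem IsCirculation.of_map {F : Type*} [FunLike F N N'] [AddMonoidHomClass F N N'] {g : F}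
    (hg : Function.Injective g) (h : IsCirculation X (g ∘ φ)) : IsCirculation X φ := fun v ↦
  hg (by simpa only [Function.comp_apply, map_sum] using h v)

theorem isCirculation_pi {κ : Type*} {φ : E → κ → N} (h : ∀ k, IsCirculation X fun c ↦ φ c k) :
    IsCirculation X φ := fun v ↦ funext fun k ↦ by
  simpa only [Finset.sum_apply] using h k v

theorem flux_congr (hP : ∀ c, X.src c ∈ P ↔ X.src c ∈ P') (hQ : ∀ c, X.tgt c ∈ Q ↔ X.tgt c ∈ Q') :
    flux X φ P Q = flux X φ P' Q' := by
  classical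
  exact Finset.sum_congr (Finset.filter_congr fun c _ ↦ by rw [hP, hQ]) fun _ _ ↦ rfl

theorem flux_compl_eq_sum {A : Set V} {C : Finset E}
    (hC : ∀ c, c ∈ C ↔ X.src c ∈ A ∧ X.tgt c ∉ A) : flux X φ A Aᶜ = ∑ c ∈ C, φ c := by
  exact Finset.sum_congr (Finset.ext fun c ↦ by simp [hC]) fun _ _ ↦ rfl

theorem flux_eq_zero (h : ∀ c, X.src c ∈ P → X.tgt c ∉ Q) : flux X φ P Q = 0 := by
  classical
  rw [flux, Finset.filter_false_of_mem fun c _ hc ↦ h c hc.1 hc.2, Finset.sum_empty]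

theorem flux_union_left (h : Disjoint P P') :
    flux X φ (P ∪ P') Q = flux X φ P Q + flux X φ P' Q := by
  classical
  rw [flux, flux, flux, ← Finset.sum_union, ← Finset.filter_or]
  · simp only [Set.mem_union, or_and_right]
  · exact Finset.disjoint_filter.2 fun c _ hc hc' ↦ h.notMem_of_mem_left hc.1 hc'.1

theorem flux_union_right (h : Disjoint Q Q') :
    flux X φ P (Q ∪ Q') = flux X φ P Q + flux X φ P Q' := by
  classical
  rw [flux, flux, flux, ← Finset.sum_union, ← Finset.filter_or]
  · simp only [Set.mem_union, and_or_left]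
  · exact Finset.disjoint_filter.2 fun c _ hc hc' ↦ h.notMem_of_mem_left hc.2 hc'.2

theorem flux_univ_left (P : Set V) : flux X φ Set.univ Q = flux X φ P Q + flux X φ Pᶜ Q := by
  rw [← flux_union_left disjoint_compl_right, Set.union_compl_self]

theorem flux_univ_right (Q : Set V) : flux X φ P Set.univ = flux X φ P Q + flux X φ P Qᶜ := by
  rw [← flux_union_right disjoint_compl_right, Set.union_compl_self]

theorem exists_add_flux {c : E} (hsrc : X.src c ∈ P) (htgt : X.tgt c ∈ Q) :
    ∃ z, flux X φ P Q = φ c + z := by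
  classical
  exact ⟨_, (Finset.add_sum_erase _ φ (by simp [hsrc, htgt])).symm⟩

end Flux

section Acyclic

theorem periodicPts_nonempty {α : Type*} [Finite α] [Nonempty α] (f : α → α) :
    (Function.periodicPts f).Nonempty := by
  obtain ⟨x⟩ := ‹Nonempty α›
  obtain ⟨m, n, hmn, heq⟩ : ∃ m n, m < n ∧ f^[m] x = f^[n] x := by
    obtain ⟨m, n, hne, heq⟩ := Finite.exists_ne_map_eq_of_infinite fun n ↦ f^[n] x
    exact hne.lt_or_gt.elim (fun h ↦ ⟨m, n, h, heq⟩) fun h ↦ ⟨n, m, h, heq.symm⟩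
  refine ⟨f^[m] x, Function.mk_mem_periodicPts (Nat.sub_pos_of_lt hmn) ?_⟩
  rw [Function.IsPeriodicPt, Function.IsFixedPt, ← Function.iterate_add_apply,
    Nat.sub_add_cancel hmn.le, heq]

variable {V E : Type*} {X : DiGraph V E}

theorem isDirectedLoop_image_periodicPts {B : Set V} [Finite B] [Nonempty B] {next : B → B}
    {out : B → E} (hsrc : ∀ v, X.src (out v) = v) (htgt : ∀ v, X.tgt (out v) = next v) :
    X.IsDirectedLoop (Subtype.val '' Function.periodicPts next)
      (out '' Function.periodicPts next) := by
  have hbij := Function.bijOn_periodicPts next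
  refine ⟨(periodicPts_nonempty next).image _, ?_, ?_⟩
  · rintro _ ⟨v, hv, rfl⟩
    rw [hsrc, htgt]
    exact ⟨Set.mem_image_of_mem _ hv, Set.mem_image_of_mem _ (hbij.mapsTo hv)⟩
  · rintro _ ⟨v, hv, rfl⟩
    refine ⟨⟨out v, ⟨Set.mem_image_of_mem _ hv, hsrc v⟩, ?_⟩, ?_⟩
    · rintro _ ⟨⟨w, -, rfl⟩, hw⟩
      rw [Subtype.ext ((hsrc w).symm.trans hw)]
    · obtain ⟨u, hu, rfl⟩ := hbij.surjOn hv
      refine ⟨out u, ⟨Set.mem_image_of_mem _ hu, htgt u⟩, ?_⟩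
      rintro _ ⟨⟨w, hw, rfl⟩, hwu⟩
      rw [hbij.injOn hw hu (Subtype.ext ((htgt w).symm.trans hwu))]

theorem exists_sink {e : E} (he : X.AcyclicWithout e) {B : Set V} (hB : B.Finite)
    (hne : B.Nonempty) (hsrc : X.src e ∉ B) : ∃ v ∈ B, ∀ c, X.src c = v → X.tgt c ∉ B := by
  by_contra! hout
  choose out hout_src hout_tgt using fun v : B ↦ hout v v.2
  have : Finite B := hB
  have : Nonempty B := hne.to_subtype
  obtain ⟨v, -, hv⟩ := he _ _ (isDirectedLoop_image_periodicPts
    (next := fun v ↦ ⟨X.tgt (out v), hout_tgt v⟩) hout_src fun _ ↦ rfl)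
  exact hsrc (hv ▸ hout_src v ▸ v.2)

variable [Fintype E] {N : Type*} [AddCommMonoid N] {φ : E → N}

theorem IsCirculation.flux_compl_insert {v : V} {B : Set V} (hφ : IsCirculation X φ) (hv : v ∉ B)
    (hsink : ∀ c, X.src c = v → X.tgt c ∉ insert v B)
    (hB : flux X φ Bᶜ B = flux X φ B Bᶜ) :
    flux X φ (insert v B)ᶜ (insert v B) = flux X φ (insert v B) (insert v B)ᶜ := by
  set A := insert v B with hA
  have hA_eq : A = B ∪ {v} := by rw [hA, Set.insert_eq, Set.union_comm]
  have hBc : Bᶜ = Aᶜ ∪ {v} := by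
    ext w; by_cases hw : w = v <;> simp [hA, hw, hv]
  have hBv : Disjoint B {v} := Set.disjoint_singleton_right.2 hv
  have hAv : Disjoint Aᶜ {v} := Set.disjoint_singleton_right.2 fun h ↦ h (Set.mem_insert v B)
  have hvA : flux X φ {v} A = 0 := flux_eq_zero hsink
  obtain ⟨hvB, hvv⟩ : flux X φ {v} B = 0 ∧ flux X φ {v} {v} = 0 :=
    ⟨flux_eq_zero fun c hc h ↦ hsink c hc (Set.mem_insert_of_mem v h),
      flux_eq_zero fun c hc h ↦ hsink c hc (h ▸ Set.mem_insert v B)⟩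
  have hinflow : flux X φ B {v} + flux X φ Aᶜ {v} = flux X φ {v} Aᶜ :=
    calc flux X φ B {v} + flux X φ Aᶜ {v} = flux X φ Set.univ {v} := by
          rw [flux_univ_left A, hA_eq, flux_union_left hBv, hvv, add_zero]
      _ = flux X φ {v} Set.univ := (isCirculation_iff_flux.1 hφ v).symm
      _ = flux X φ {v} Aᶜ := by rw [flux_univ_right A, hvA, zero_add]
  calc flux X φ Aᶜ A = flux X φ Aᶜ B + flux X φ Aᶜ {v} := by
        rw [← flux_union_right hBv, ← hA_eq]
    _ = flux X φ Bᶜ B + flux X φ Aᶜ {v} := by rw [hBc, flux_union_left hAv, hvB, add_zero]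
    _ = flux X φ B Aᶜ + (flux X φ B {v} + flux X φ Aᶜ {v}) := by
        rw [hB, hBc, flux_union_right hAv, add_assoc]
    _ = flux X φ A Aᶜ := by rw [hinflow, ← flux_union_left hBv, ← hA_eq]

theorem IsCirculation.flux_compl_of_finite {e : E} (hφ : IsCirculation X φ)
    (he : X.AcyclicWithout e) {A : Set V} (hA : A.Finite) (hsrc : X.src e ∉ A) :
    flux X φ Aᶜ A = flux X φ A Aᶜ := by
  induction hn : A.ncard generalizing A with
  | zero =>
    obtain rfl := (Set.ncard_eq_zero hA).1 hn
    rw [flux_eq_zero (by simp), flux_eq_zero (by simp)]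
  | succ n ih =>
    obtain ⟨v, hv, hsink⟩ := exists_sink he hA (Set.nonempty_of_ncard_ne_zero (by omega)) hsrc
    rw [← Set.insert_sdiff_self_of_mem hv] at hsink ⊢
    refine hφ.flux_compl_insert (by simp) hsink (ih (hA.sdiff) (fun h ↦ hsrc h.1) ?_)
    rw [Set.ncard_sdiff_singleton_of_mem hv, hn, Nat.add_sub_cancel]

/-- Without additive inverses the internal values cannot be cancelled from the vertex equations;
peeling off sinks avoids cancellation. -/
theorem IsCirculation.flux_compl {e : E} (hφ : IsCirculation X φ) (he : X.AcyclicWithout e)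
    {A : Set V} (hsrc : X.src e ∉ A) : flux X φ Aᶜ A = flux X φ A Aᶜ := by
  have hfin : (A ∩ (Set.range X.src ∪ Set.range X.tgt)).Finite :=
    .inter_of_right ((Set.finite_range _).union (Set.finite_range _)) A
  have h := hφ.flux_compl_of_finite he hfin fun h ↦ hsrc h.1
  convert h using 1 <;> exact flux_congr (by simp) (by simp)

end Acyclic

section WeakDuality

variable {M : Type*} [AddCommMonoid M]

theorem NatLE.refl (x : M) : NatLE x x := ⟨0, (add_zero x).symm⟩

theorem NatLE.trans {x y z : M} (h : NatLE x y) (h' : NatLE y z) : NatLE x z := by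
  obtain ⟨a, rfl⟩ := h
  obtain ⟨b, rfl⟩ := h'
  exact ⟨a + b, add_assoc _ _ _⟩

theorem NatLE.sum {ι : Type*} (s : Finset ι) {f g : ι → M} (h : ∀ i, NatLE (f i) (g i)) :
    NatLE (∑ i ∈ s, f i) (∑ i ∈ s, g i) := by
  choose z hz using h
  exact ⟨∑ i ∈ s, z i, by simp only [hz, Finset.sum_add_distrib]⟩

variable {V E : Type*} [Fintype E] {X : DiGraph V E} {ω φ : E → M} {e : E} {C : Finset E}

theorem IsFlow.natLE_sum_of_isProperEdgeCut (hφ : IsFlow X ω φ) (he : X.AcyclicWithout e)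
    (hC : X.IsProperEdgeCut e C) : NatLE (φ e) (∑ c ∈ C, ω c) := by
  obtain ⟨hcap, hcirc⟩ := hφ
  obtain ⟨A, htgt, hsrc, hmem⟩ := hC
  have hle : NatLE (φ e) (flux X φ Aᶜ A) := exists_add_flux hsrc htgt
  rw [IsCirculation.flux_compl hcirc he hsrc, flux_compl_eq_sum hmem] at hle
  exact hle.trans (NatLE.sum C hcap)

theorem IsFlow.natLE_sum_of_isEdgeCut (hφ : IsFlow X ω φ) (he : X.AcyclicWithout e)
    (hC : X.IsEdgeCut e C) : NatLE (φ e) (∑ c ∈ C, ω c) := by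
  rcases hC with rfl | hC
  · simpa using hφ.1 e
  · exact hφ.natLE_sum_of_isProperEdgeCut he hC

end WeakDuality

section Hoffman

variable {V E : Type*} [Fintype E] (X : DiGraph V E)

/-- By how much the upper bounds `u` on the edges leaving `A` exceed the lower bounds `ℓ` on the
edges entering `A`; Hoffman's condition is that this is never negative. -/
noncomputable def slack (ℓ u : E → ℤ) (A : Set V) : ℤ := flux X u A Aᶜ - flux X ℓ Aᶜ A

variable {X} {ℓ u : E → ℤ}

open scoped Classical in
theorem flux_single [DecidableEq E] {N : Type*} [AddCommMonoid N] (c : E) (n : N) (P Q : Set V) :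
    flux X (Pi.single c n) P Q = if X.src c ∈ P ∧ X.tgt c ∈ Q then n else 0 := by
  rw [flux, Finset.sum_filter, Finset.sum_eq_single c] <;> simp +contextual

theorem slack_add_single_left [DecidableEq E] {c : E} {A : Set V} :
    slack X (ℓ + Pi.single c 1) u A = slack X ℓ u A - flux X (Pi.single c 1) Aᶜ A := by
  simp only [slack, flux, Pi.add_apply, Finset.sum_add_distrib, sub_add_eq_sub_sub]

theorem slack_sub_single_right [DecidableEq E] {c : E} {A : Set V} :
    slack X ℓ (u - Pi.single c 1) A = slack X ℓ u A - flux X (Pi.single c 1) A Aᶜ := by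
  simp only [slack, flux, Pi.sub_apply, Finset.sum_sub_distrib, sub_right_comm]

theorem slack_union_add_slack_inter_lt (hℓu : ℓ ≤ u) {c : E} (hc : ℓ c < u c) {A B : Set V}
    (hA : X.src c ∉ A ∧ X.tgt c ∈ A) (hB : X.src c ∈ B ∧ X.tgt c ∉ B) :
    slack X ℓ u (A ∪ B) + slack X ℓ u (A ∩ B) < slack X ℓ u A + slack X ℓ u B := by
  simp only [slack, flux, Finset.sum_filter, ← Finset.sum_sub_distrib, ← Finset.sum_add_distrib]
  refine Finset.sum_lt_sum (fun d _ ↦ ?_) ⟨c, Finset.mem_univ c, ?_⟩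
  · have := hℓu d
    by_cases X.src d ∈ A <;> by_cases X.tgt d ∈ A <;> by_cases X.src d ∈ B <;>
      by_cases X.tgt d ∈ B <;> simp [*]
  · simp [hA, hB, hc]

/-- Otherwise `c` enters a tight set and leaves another one, which are then uncrossed. -/
theorem slack_add_single_nonneg_or_slack_sub_single_nonneg [DecidableEq E] (hℓu : ℓ ≤ u)
    (h : ∀ A, 0 ≤ slack X ℓ u A) {c : E} (hc : ℓ c < u c) :
    (∀ A, 0 ≤ slack X (ℓ + Pi.single c 1) u A) ∨ ∀ A, 0 ≤ slack X ℓ (u - Pi.single c 1) A := by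
  by_contra! htight
  obtain ⟨⟨A, hA⟩, B, hB⟩ := htight
  rw [slack_add_single_left, flux_single] at hA
  rw [slack_sub_single_right, flux_single] at hB
  have hA₀ := h A
  have hB₀ := h B
  split_ifs at hA hB with hcA hcB <;> try omega
  have huncross := slack_union_add_slack_inter_lt hℓu hc hcA hcB
  linarith [h (A ∪ B), h (A ∩ B)]

theorem isCirculation_of_slack_nonneg (h : ∀ A, 0 ≤ slack X u u A) : IsCirculation X u := by
  refine isCirculation_iff_flux.2 fun v ↦ ?_
  have hout := h {v}
  have hin := h {v}ᶜ
  rw [slack, compl_compl] at hin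
  rw [slack] at hout
  rw [flux_univ_left {v}, flux_univ_right {v}]
  linarith

theorem exists_isCirculation_of_slack_nonneg (hℓu : ℓ ≤ u) (h : ∀ A, 0 ≤ slack X ℓ u A) :
    ∃ f : E → ℤ, IsCirculation X f ∧ ℓ ≤ f ∧ f ≤ u := by
  classical
  have hgap (c : E) : 0 ≤ u c - ℓ c := sub_nonneg.2 (hℓu c)
  obtain ⟨n, hn⟩ := Int.eq_ofNat_of_zero_le (Fintype.sum_nonneg hgap)
  induction n generalizing ℓ u with
  | zero =>
    obtain rfl : u = ℓ := funext fun c ↦ sub_eq_zero.1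
      ((Finset.sum_eq_zero_iff_of_nonneg fun c _ ↦ hgap c).1 hn c (Finset.mem_univ c))
    exact ⟨u, isCirculation_of_slack_nonneg h, le_rfl, le_rfl⟩
  | succ n ih =>
    obtain ⟨c, -, hc⟩ : ∃ c ∈ Finset.univ, 0 < u c - ℓ c :=
      Finset.exists_lt_of_sum_lt (by simp [hn])
    have hsingle : ∑ d, (Pi.single c 1 : E → ℤ) d = 1 := by simp
    have hle : ℓ + Pi.single c 1 ≤ u := fun d ↦ by
      rcases eq_or_ne d c with rfl | hd
      · simpa using Int.add_one_le_iff.2 (sub_pos.1 hc)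
      · simpa [hd] using hℓu d
    rcases slack_add_single_nonneg_or_slack_sub_single_nonneg hℓu h (sub_pos.1 hc) with h' | h'
    · obtain ⟨f, hf, hℓf, hfu⟩ := ih hle h' (fun d ↦ sub_nonneg.2 (hle d)) (by
        simp only [Pi.add_apply, sub_add_eq_sub_sub, Finset.sum_sub_distrib, hsingle] at hn ⊢
        omega)
      exact ⟨f, hf, (le_add_of_nonneg_right (Pi.single_nonneg.2 zero_le_one)).trans hℓf, hfu⟩
    · have hle' : ℓ ≤ u - Pi.single c 1 := le_sub_iff_add_le.2 hle
      obtain ⟨f, hf, hℓf, hfu⟩ := ih hle' h' (fun d ↦ sub_nonneg.2 (hle' d)) (by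
        simp only [Pi.sub_apply, sub_right_comm, Finset.sum_sub_distrib, hsingle] at hn ⊢
        omega)
      exact ⟨f, hf, hℓf, hfu.trans (sub_le_self _ (Pi.single_nonneg.2 zero_le_one))⟩

theorem exists_nat_isCirculation_apply_eq (X : DiGraph V E) (t : E → ℕ) (e : E) (μ : ℕ)
    (hcut : ∀ C, X.IsEdgeCut e C → μ ≤ ∑ c ∈ C, t c) :
    ∃ f : E → ℕ, IsCirculation X f ∧ f ≤ t ∧ f e = μ := by
  classical
  have hμ : μ ≤ t e := by simpa using hcut {e} (.inl rfl)
  let u : E → ℤ := Function.update (fun c ↦ (t c : ℤ)) e μ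
  have hu : 0 ≤ u := le_update_iff.2 ⟨Int.natCast_nonneg μ, fun c _ ↦ Int.natCast_nonneg (t c)⟩
  have hℓu : Pi.single e (μ : ℤ) ≤ u := fun c ↦ by
    rcases eq_or_ne c e with rfl | hc <;> simp [u, *]
  have hslack (A : Set V) : 0 ≤ slack X (Pi.single e (μ : ℤ)) u A := by
    rw [slack, flux_single, sub_nonneg]
    split_ifs with he
    · let C : Finset E := {c | X.src c ∈ A ∧ X.tgt c ∉ A}
      have hC (c : E) : c ∈ C ↔ X.src c ∈ A ∧ X.tgt c ∉ A := by simp [C]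
      have heC : e ∉ C := fun h ↦ he.1 ((hC e).1 h).1
      rw [flux_compl_eq_sum hC, Finset.sum_update_of_notMem heC]
      exact_mod_cast hcut C (.inr ⟨A, he.2, he.1, hC⟩)
    · exact Finset.sum_nonneg fun c _ ↦ hu c
  obtain ⟨f, hf, hℓf, hfu⟩ := exists_isCirculation_of_slack_nonneg hℓu hslack
  have hf₀ : 0 ≤ f := (Pi.single_nonneg.2 (Int.natCast_nonneg μ)).trans hℓf
  lift f to E → ℕ using hf₀
  have hfe : f e = μ := by
    have hge := hℓf e
    have hle := hfu e
    simp only [Pi.single_eq_same, u, Function.update_self, Nat.cast_le] at hge hle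
    exact hle.antisymm hge
  refine ⟨f, hf.of_map (g := Nat.castAddMonoidHom ℤ) Nat.cast_injective, fun c ↦ ?_, hfe⟩
  rcases eq_or_ne c e with rfl | hc
  · exact hfe.trans_le hμ
  · simpa [u, hc] using hfu c

theorem exists_isCirculation_apply_eq (X : DiGraph V E) {κ : Type*} (t : E → κ → ℕ) (e : E)
    (μ : κ → ℕ) (hcut : ∀ C, X.IsEdgeCut e C → μ ≤ ∑ c ∈ C, t c) :
    ∃ f : E → κ → ℕ, IsCirculation X f ∧ f ≤ t ∧ f e = μ := by
  choose f hf hft hfe using fun k ↦ exists_nat_isCirculation_apply_eq X (fun c ↦ t c k) e (μ k)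
    fun C hC ↦ by simpa only [Finset.sum_apply] using hcut C hC k
  exact ⟨fun c k ↦ f k c, isCirculation_pi hf, fun c k ↦ hft k c, funext hfe⟩

end Hoffman

section Decomposability

universe u v w

variable {S : Type u} [CommSemiring S]

/-- Tensoring with a semimodule that has a finite basis is taking a finite power. -/
noncomputable def tensorPiEquiv {κ : Type*} [Fintype κ] [DecidableEq κ] {F : Type*}
    [AddCommMonoid F] [Module S F] (r : F ≃ₗ[S] (κ → S)) (N : Type*) [AddCommMonoid N]
    [Module S N] : F ⊗[S] N ≃ₗ[S] (κ → N) :=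
  TensorProduct.comm S F N ≪≫ₗ TensorProduct.congr (.refl S N) r ≪≫ₗ
    TensorProduct.piScalarRight S S N κ

theorem tensorPiEquiv_lTensor {κ : Type*} [Fintype κ] [DecidableEq κ] {F N N' : Type*}
    [AddCommMonoid F] [Module S F] [AddCommMonoid N] [Module S N] [AddCommMonoid N'] [Module S N']
    (r : F ≃ₗ[S] (κ → S)) (p : N →ₗ[S] N') (t : F ⊗[S] N) (k : κ) :
    tensorPiEquiv r N' (p.lTensor F t) k = p (tensorPiEquiv r N t k) := by
  induction t using TensorProduct.induction_on with
  | zero => simp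
  | tmul x y => simp [tensorPiEquiv]
  | add x y hx hy => simp only [map_add, Pi.add_apply, hx, hy]

theorem flatSemimodule_of_equiv_pi {κ : Type*} [Finite κ] {F : Type (max u w)}
    [AddCommMonoid F] [Module S F] (r : F ≃ₗ[S] (κ → S)) : FlatSemimodule.{u, w} S F := by
  classical
  have := Fintype.ofFinite κ
  intro A B _ _ _ _ f g
  constructor
  · intro t t' h
    refine (tensorPiEquiv r _).injective (funext fun k ↦ Subtype.ext ?_)
    have hk := congrFun (congrArg (tensorPiEquiv r A) h) k
    rwa [tensorPiEquiv_lTensor, tensorPiEquiv_lTensor] at hk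
  · intro t ht
    have hmem (k : κ) : tensorPiEquiv r A t k ∈ LinearMap.eqLocus f g := by
      have hk := congrFun (congrArg (tensorPiEquiv r B) ht) k
      rwa [tensorPiEquiv_lTensor, tensorPiEquiv_lTensor] at hk
    refine ⟨(tensorPiEquiv r _).symm fun k ↦ ⟨tensorPiEquiv r A t k, hmem k⟩,
      (tensorPiEquiv r A).injective (funext fun k ↦ ?_)⟩
    rw [tensorPiEquiv_lTensor, LinearEquiv.apply_symm_apply]
    rfl

variable {M : Type v} [AddCommMonoid M] [Module S M] {V E : Type*} [Fintype E] {X : DiGraph V E}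

theorem isDecomposable_comp_of_flat {F : Type (max u v)} [AddCommMonoid F] [Module S F]
    (hF : FlatSemimodule.{u, v} S F) (ψ : F →ₗ[S] M) {f : E → F} (hf : IsCirculation X f) :
    IsDecomposable S X (ψ ∘ f) :=
  ⟨{ onV := fun _ ↦ F, onE := fun _ ↦ F, res := fun _ _ _ ↦ LinearMap.id },
    ⟨fun _ ↦ hF, fun _ ↦ hF⟩,
    { onV := fun _ ↦ ψ, onE := fun _ ↦ ψ, naturality := fun _ _ _ _ ↦ rfl },
    { val := fun _ c _ ↦ f c, compat := fun _ _ _ _ _ ↦ rfl, conserve := hf },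
    fun _ _ _ ↦ rfl⟩

variable (S) in
theorem isDecomposable_comp_linearMap {κ : Type*} [Finite κ] (ψ : (κ → ℕ) →ₗ[ℕ] M)
    {f : E → κ → ℕ} (hf : IsCirculation X f) : IsDecomposable S X (ψ ∘ f) := by
  classical
  have := Fintype.ofFinite κ
  let r := Fintype.equivFin κ
  let up : (Fin (Fintype.card κ) → S) ≃ₗ[S] ULift.{v} (Fin (Fintype.card κ) → S) :=
    ULift.moduleEquiv.symm
  let ψS := Fintype.linearCombination S fun i ↦ ψ (Pi.single (r.symm i) 1)
  let cast : (κ → ℕ) →+ (Fin (Fintype.card κ) → S) :=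
    ((Nat.castAddMonoidHom S).compLeft _).comp (LinearMap.funLeft ℕ ℕ r.symm).toAddMonoidHom
  have hψ (b : κ → ℕ) : ψS (cast b) = ψ b := by
    rw [linearMap_pi_apply_eq_sum_single ψ b, Fintype.linearCombination_apply, ← r.symm.sum_comp]
    exact Finset.sum_congr rfl fun i _ ↦ Nat.cast_smul_eq_nsmul S _ _
  have h := isDecomposable_comp_of_flat (flatSemimodule_of_equiv_pi up.symm)
    (ψS ∘ₗ up.symm.toLinearMap) ((hf.map cast).map up)
  convert h using 1
  exact funext fun c ↦ by simp [hψ]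

end Decomposability

section StrongDuality

universe u v

variable (S : Type u) [CommSemiring S] {M : Type v} [AddCommMonoid M] [Module S M]
  {V E : Type*} [Fintype E] (X : DiGraph V E) (ω : E → M) (e : E)

theorem natLE_iff_le [Preorder M] [CanonicallyOrderedAdd M] {x y : M} : NatLE x y ↔ x ≤ y :=
  le_iff_exists_add.symm

theorem exists_isDecomposable_flow [SemilatticeInf M] [CanonicallyOrderedAdd M] [InfDistribAdd M] :
    ∃ φ : E → M, IsFlow X ω φ ∧ IsDecomposable S X φ ∧
      ∀ b, (∀ C, X.IsEdgeCut e C → NatLE b (∑ c ∈ C, ω c)) → NatLE b (φ e) := by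
  classical
  let cuts : Finset (Finset E) := {C | X.IsEdgeCut e C}
  have hmem {C : Finset E} : C ∈ cuts ↔ X.IsEdgeCut e C := by simp [cuts]
  have hcuts : cuts.Nonempty := ⟨{e}, hmem.2 (.inl rfl)⟩
  let Ω := Fintype.linearCombination ℕ ω
  have hΩ (c : E) : Ω (Pi.single c 1) = ω c := by simp [Ω, Fintype.linearCombination_apply_single]
  obtain ⟨κ, _, ψ, T, hψT, hle⟩ :=
    exists_factorization_inf'_le Ω hcuts fun C ↦ ∑ c ∈ C, Pi.single c 1
  have hψ := monotone_of_canonicallyOrderedAdd ψ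
  have hcut (C : Finset E) (hC : X.IsEdgeCut e C) :
      cuts.inf' hcuts (T ∘ fun C ↦ ∑ c ∈ C, Pi.single c 1) ≤ ∑ c ∈ C, T (Pi.single c 1) := by
    rw [← map_sum]
    exact Finset.inf'_le (T ∘ fun C ↦ ∑ c ∈ C, Pi.single c 1) (hmem.2 hC)
  obtain ⟨f, hf, hfT, hfe⟩ := exists_isCirculation_apply_eq X (fun c ↦ T (Pi.single c 1)) e _ hcut
  refine ⟨ψ ∘ f, ⟨fun c ↦ natLE_iff_le.2 ?_, hf.map ψ⟩, isDecomposable_comp_linearMap S ψ hf,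
    fun b hb ↦ natLE_iff_le.2 ?_⟩
  · calc ψ (f c) ≤ ψ (T (Pi.single c 1)) := hψ (hfT c)
      _ = ω c := by rw [← LinearMap.comp_apply, hψT, hΩ]
  · rw [Function.comp_apply, hfe]
    refine le_trans (Finset.le_inf' _ _ fun C hC ↦ ?_) hle
    simpa [hΩ, natLE_iff_le] using hb C (hmem.1 hC)

theorem NaturallyInfSemilatticeOrdered.antisymm (hM : NaturallyInfSemilatticeOrdered M) {x y : M}
    (hxy : NatLE x y) (hyx : NatLE y x) : x = y := by
  refine (hM.1 x x).unique ⟨?_, fun b hb ↦ hb x (.inl rfl)⟩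
    ⟨?_, fun b hb ↦ (hb x (.inl rfl)).trans hxy⟩
  · rintro z (rfl | rfl) <;> exact .refl _
  · rintro z (rfl | rfl) <;> exact hyx

/-- The natural preorder as a meet semilattice, for use as a local instance. -/
noncomputable abbrev NaturallyInfSemilatticeOrdered.semilatticeInf
    (hM : NaturallyInfSemilatticeOrdered M) : SemilatticeInf M where
  le := NatLE
  le_refl := .refl
  le_trans _ _ _ := .trans
  le_antisymm _ _ := hM.antisymm
  inf x y := (hM.1 x y).choose
  inf_le_left x y := (hM.1 x y).choose_spec.1.1 x (.inl rfl)
  inf_le_right x y := (hM.1 x y).choose_spec.1.1 y (.inr rfl)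
  le_inf x y z hy hz := (hM.1 y z).choose_spec.1.2 x (by rintro w (rfl | rfl); exacts [hy, hz])

theorem NaturallyInfSemilatticeOrdered.canonicallyOrderedAdd
    (hM : NaturallyInfSemilatticeOrdered M) :
    let _ := hM.semilatticeInf; CanonicallyOrderedAdd M :=
  let _ := hM.semilatticeInf
  { exists_add_of_le := id
    le_add_self := fun a b ↦ ⟨b, add_comm b a⟩
    le_self_add := fun _ b ↦ ⟨b, rfl⟩ }

theorem NaturallyInfSemilatticeOrdered.infDistribAdd (hM : NaturallyInfSemilatticeOrdered M) :
    let _ := hM.semilatticeInf; InfDistribAdd M :=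
  let _ := hM.semilatticeInf
  ⟨fun x y z ↦ (hM.1 (x + z) (y + z)).unique (hM.2 x y z _ (hM.1 x y).choose_spec.1)
    (hM.1 (x + z) (y + z)).choose_spec.1⟩

theorem NaturallyInfSemilatticeOrdered.exists_isDecomposable_flow
    (hM : NaturallyInfSemilatticeOrdered M) :
    ∃ φ : E → M, IsFlow X ω φ ∧ IsDecomposable S X φ ∧
      ∀ b, (∀ C, X.IsEdgeCut e C → NatLE b (∑ c ∈ C, ω c)) → NatLE b (φ e) := by
  let _ := hM.semilatticeInf
  have := hM.canonicallyOrderedAdd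
  have := hM.infDistribAdd
  exact AlgMFMC.exists_isDecomposable_flow S X ω e

end StrongDuality

end AlgMFMC

theorem mainTheorem3_general {S : Type*} [CommSemiring S] {M : Type*} [AddCommMonoid M]
    [Module S M] (hinf : AlgMFMC.NaturallyInfSemilatticeOrdered M)
    {V E : Type*} [Fintype E] (X : AlgMFMC.DiGraph V E) (ω : E → M)
    (e : E) (hacyclic : X.AcyclicWithout e) :
    ∃ m ∈ AlgMFMC.flowValues S X ω e,
      AlgMFMC.IsNatLUB (AlgMFMC.flowValues S X ω e) m ∧
      AlgMFMC.IsNatGLB {x : M | ∃ C : Finset E, X.IsEdgeCut e C ∧ ∑ c ∈ C, ω c = x} m ∧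
      ((∀ x : M, AlgMFMC.NatLE x (ω e)) →
        AlgMFMC.IsNatGLB {x : M | ∃ C : Finset E, X.IsProperEdgeCut e C ∧ ∑ c ∈ C, ω c = x} m) := by
  obtain ⟨φ, hφ, hdec, hmax⟩ := hinf.exists_isDecomposable_flow S X ω e
  have hmem : φ e ∈ AlgMFMC.flowValues S X ω e := ⟨φ, hφ, hdec, rfl⟩
  refine ⟨φ e, hmem, ⟨?_, fun b hb ↦ hb _ hmem⟩, ⟨?_, fun b hb ↦ ?_⟩,
    fun htop ↦ ⟨?_, fun b hb ↦ ?_⟩⟩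
  · rintro _ ⟨ψ, hψ, -, rfl⟩
    exact hmax _ fun C ↦ hψ.natLE_sum_of_isEdgeCut hacyclic
  · rintro _ ⟨C, hC, rfl⟩
    exact hφ.natLE_sum_of_isEdgeCut hacyclic hC
  · exact hmax b fun C hC ↦ hb _ ⟨C, hC, rfl⟩
  · rintro _ ⟨C, hC, rfl⟩
    exact hφ.natLE_sum_of_isProperEdgeCut hacyclic hC
  · refine hmax b fun C hC ↦ ?_
    rcases hC with rfl | hC
    · simpa using htop b
    · exact hb _ ⟨C, hC, rfl⟩

theorem mainTheorem3 {S : Type*} [CommSemiring S] {M : Type*} [AddCommMonoid M] [Module S M]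
    (hcomplete : AlgMFMC.NaturallyComplete M)
    (hinf : AlgMFMC.NaturallyInfSemilatticeOrdered M)
    {V E : Type*} [Finite V] [Fintype E] (X : AlgMFMC.DiGraph V E) (ω : E → M)
    (e : E) (hacyclic : X.AcyclicWithout e) :
    ∃ m : M,
      AlgMFMC.IsNatLUB (AlgMFMC.flowValues S X ω e) m ∧
      AlgMFMC.IsNatGLB {x : M | ∃ C : Finset E, X.IsEdgeCut e C ∧ ∑ c ∈ C, ω c = x} m ∧
      ((∀ x : M, AlgMFMC.NatLE x (ω e)) →
        AlgMFMC.IsNatGLB {x : M | ∃ C : Finset E, X.IsProperEdgeCut e C ∧ ∑ c ∈ C, ω c = x} m) := by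
  obtain ⟨m, -, hm⟩ := mainTheorem3_general (S := S) hinf X ω e hacyclic
  exact ⟨m, hm⟩
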